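/- Let $d\in\{2,3\}$ and let $\Omega\subset\mathbb R^d$ be a bounded connected nonempty open set (for instance one with polygonal or Lipschitz polyhedral boundary; no boundary regularity is needed for the statement below). Write $\mathbf H^1_0(\Omega)=H^1_0(\Omega)^d$ with inner product $(\mathbf v,\mathbf w)_{\mathbf H^1_0}=\sum_{i,j}(\partial_j v_i,\partial_j w_i)_{L^2(\Omega)}$, let $\mathbf H^{-1}(\Omega)$ be its dual, $L^2_{zmv}(\Omega)=\{q\in L^2(\Omega):\int_\Omega q=0\}$, $\mathbf V=\{\mathbf v\in\mathbf H^1_0(\Omega):\operatorname{div}\mathbf v=0\}$, and let $\mathbf V^\perp$ be the orthogonal complement of $\mathbf V$ in $\mathbf H^1_0(\Omega)$. Let $\mathbf f'\in\mathbf H^{-1}(\Omega)$ be decomposed as $\mathbf f'=\operatorname{grad} z_{\mathbf f'}+\operatorname{curl}\operatorname{curl}\mathbf w_{\mathbf f'}$ in the sense of distributions on $\Omega$, with $z_{\mathbf f'}\in L^2_{zmv}(\Omega)$ and $\mathbf w_{\mathbf f'}\in\mathbf V$. (In dimension 2, $\operatorname{curl}\operatorname{curl}$ is the vector curl $s\mapsto(\partial_2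 s,-\partial_1 s)$ of the scalar curl $\mathbf w\mapsto\partial_1w_2-\partial_2w_1$.) Let $q\in L^2_{zmv}(\Omega)$ and let $\tilde{\mathbf v}_q\in\mathbf V^\perp$ satisfy $\operatorname{div}\tilde{\mathbf v}_q=q$. Then $$\langle\mathbf f',\tilde{\mathbf v}_q\rangle_{\mathbf H^{-1}(\Omega),\mathbf H^1_0(\Omega)}=-(z_{\mathbf f'},q)_{L^2(\Omega)}.$$ Moreover, for all $\nu>0$, $\lambda\in\mathbb R$ and $\mathbf v\in\mathbf H^1_0(\Omega)$, the linear form $\ell(\mathbf v,q)=\langle\mathbf f',\mathbf v\rangle-(g,q)_{L^2(\Omega)}$ of the Stokes problem with data $(\mathbf f',g)$, $g=0$, composed with the map $T_\lambda(\mathbf v,q)=(\lambda\mathbf v-\nu^{-1}\tilde{\mathbf v}_q,-\lambda q)$, has the expression $$\ell\bigl(T_\lambda(\mathbf v,q)\bigr)=\lambda\langle\mathbf f',\mathbf v\rangle_{\mathbf H^{-1}(\Omega),\mathbf H^1_0(\Omega)}+\nu^{-1}(z_{\mathbf f'},q)_{L^2(\Omega)}.$$ -/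

import Mathlib

open MeasureTheory TopologicalSpace
open scoped Distributions LineDeriv

namespace Stokes

noncomputable section

/-- The Euclidean space `ℝ^d`. -/
abbrev Rn (d : ℕ) := EuclideanSpace ℝ (Fin d)

/-- The `j`-th vector of the canonical basis of `ℝ^d`. -/
abbrev e {d : ℕ} (j : Fin d) : Rn d := EuclideanSpace.single j (1 : ℝ)

/-- The Hilbert space `L²(Ω)` (Lebesgue measure). -/
abbrev L2 {d : ℕ} (Ω : Opens (Rn d)) := Lp ℝ 2 (volume.restrict (Ω : Set (Rn d)))

/-- `L²_zmv(Ω)`: the functions of `L²(Ω)` with zero mean value. On a bounded `Ω` the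
integrability requirement is automatic. -/
def L2zmv {d : ℕ} (Ω : Opens (Rn d)) : Submodule ℝ (L2 Ω) where
  carrier := {q | IntegrableOn q (Ω : Set (Rn d)) ∧ ∫ x in (Ω : Set (Rn d)), q x = 0}
  zero_mem' := by
    refine ⟨(integrable_zero _ _ _).congr (Lp.coeFn_zero _ _ _).symm, ?_⟩
    rw [integral_congr_ae (Lp.coeFn_zero ℝ 2 _)]
    simp
  add_mem' := by
    rintro p q ⟨hp, hp0⟩ ⟨hq, hq0⟩
    refine ⟨(Integrable.add hp hq).congr (Lp.coeFn_add p q).symm, ?_⟩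
    rw [integral_congr_ae (Lp.coeFn_add p q)]
    simp only [Pi.add_apply]
    rw [integral_add hp hq, hp0, hq0, add_zero]
  smul_mem' := by
    rintro c q ⟨hq, hq0⟩
    refine ⟨(Integrable.smul c hq).congr (Lp.coeFn_smul c q).symm, ?_⟩
    rw [integral_congr_ae (Lp.coeFn_smul c q)]
    simp only [Pi.smul_apply]
    rw [integral_smul, hq0, smul_zero]

/-! ### Distributions defined by square-integrable functions -/

lemma locallyIntegrableOn_L2 {d : ℕ} {Ω : Opens (Rn d)} (u : L2 Ω) :
    LocallyIntegrableOn u (Ω : Set (Rn d)) (volume.restrict (Ω : Set (Rn d))) :=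
  ((Lp.memLp u).locallyIntegrable (by norm_num)).locallyIntegrableOn _

/-- The distribution `φ ↦ ∫_Ω φ u` defined by `u ∈ L²(Ω)`. -/
def toDist {d : ℕ} {Ω : Opens (Rn d)} (u : L2 Ω) : 𝓓'(Ω, ℝ) :=
  ContinuousLinearMap.toUniformConvergenceCLM _ _ _
    (TestFunction.integralAgainstBilinCLM (ContinuousLinearMap.mul ℝ ℝ)
      (volume.restrict (Ω : Set (Rn d))) u)

lemma toDist_apply {d : ℕ} {Ω : Opens (Rn d)} (u : L2 Ω) (φ : 𝓓(Ω, ℝ)) :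
    toDist u φ = ∫ x in (Ω : Set (Rn d)), φ x * u x := by
  change TestFunction.integralAgainstBilinCLM (ContinuousLinearMap.mul ℝ ℝ)
      (volume.restrict (Ω : Set (Rn d))) u φ = _
  rw [TestFunction.integralAgainstBilinCLM_eq_integral (locallyIntegrableOn_L2 u)]
  rfl

lemma integrable_test_mul {d : ℕ} {Ω : Opens (Rn d)} (u : L2 Ω) (φ : 𝓓(Ω, ℝ)) :
    IntegrableOn (fun x ↦ φ x * u x) (Ω : Set (Rn d)) :=
  φ.integrable_bilin (ContinuousLinearMap.mul ℝ ℝ) (locallyIntegrableOn_L2 u)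

lemma toDist_add {d : ℕ} {Ω : Opens (Rn d)} (u v : L2 Ω) :
    toDist (u + v) = toDist u + toDist v := by
  ext φ
  change toDist (u + v) φ = toDist u φ + toDist v φ
  rw [toDist_apply, toDist_apply, toDist_apply,
    ← integral_add (integrable_test_mul u φ) (integrable_test_mul v φ)]
  refine integral_congr_ae ?_
  filter_upwards [Lp.coeFn_add u v] with x hx
  rw [hx, Pi.add_apply, mul_add]

lemma toDist_smul {d : ℕ} {Ω : Opens (Rn d)} (c : ℝ) (u : L2 Ω) :
    toDist (c • u) = c • toDist u := by
  ext φ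
  change toDist (c • u) φ = c • toDist u φ
  rw [toDist_apply, toDist_apply, ← integral_smul]
  refine integral_congr_ae ?_
  filter_upwards [Lp.coeFn_smul c u] with x hx
  simp only [hx, Pi.smul_apply, smul_eq_mul]
  ring

/-! ### Sobolev spaces -/

/-- `H¹(Ω)`: pairs `(u, g)` with `u ∈ L²(Ω)` and `g = (g_j) ∈ L²(Ω)^d` such that
`∂_j u = g_j` in the sense of distributions. (`g` is determined by `u`.) The product topology is
that of the usual norm `(‖u‖² + ‖∇u‖²)^{1/2}`. -/
def H1 {d : ℕ} (Ω : Opens (Rn d)) : Submodule ℝ (L2 Ω × (Fin d → L2 Ω)) where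
  carrier := {p | ∀ j, ∂_{e j} (toDist p.1) = toDist (p.2 j)}
  zero_mem' := by
    intro j
    have h : toDist (0 : L2 Ω) = 0 := by simpa using toDist_smul (0 : ℝ) (0 : L2 Ω)
    change ∂_{e j} (toDist (0 : L2 Ω)) = toDist (0 : L2 Ω)
    rw [h, LineDeriv.lineDerivOp_zero]
  add_mem' := by
    intro p r hp hr j
    change ∂_{e j} (toDist (p.1 + r.1)) = toDist (p.2 j + r.2 j)
    rw [toDist_add, toDist_add, LineDeriv.lineDerivOp_add, hp j, hr j]
  smul_mem' := by
    intro c p hp j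
    change ∂_{e j} (toDist (c • p.1)) = toDist (c • p.2 j)
    rw [toDist_smul, toDist_smul, LineDeriv.lineDerivOp_smul, hp j]

lemma test_memLp {d : ℕ} {Ω : Opens (Rn d)} (φ : 𝓓(Ω, ℝ)) :
    MemLp φ 2 (volume.restrict (Ω : Set (Rn d))) :=
  φ.continuous.memLp_of_hasCompactSupport φ.hasCompactSupport

/-- A test function as an element of `L²(Ω)`. -/
def testL2 {d : ℕ} (Ω : Opens (Rn d)) : 𝓓(Ω, ℝ) →ₗ[ℝ] L2 Ω where
  toFun φ := (test_memLp φ).toLp φ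
  map_add' _ _ := rfl
  map_smul' _ _ := rfl

lemma testL2_mem_H1 {d : ℕ} {Ω : Opens (Rn d)} (φ : 𝓓(Ω, ℝ)) :
    ((testL2 Ω φ, fun j ↦ testL2 Ω (∂_{e j} φ)) : L2 Ω × (Fin d → L2 Ω)) ∈ H1 Ω := by
  have key (φ ψ : 𝓓(Ω, ℝ)) :
      toDist (testL2 Ω φ) ψ = ∫ x, ψ x * φ x := by
    rw [toDist_apply]
    have h1 : ∫ x in (Ω : Set (Rn d)), ψ x * (testL2 Ω φ) x =
        ∫ x in (Ω : Set (Rn d)), ψ x * φ x := by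
      refine integral_congr_ae ?_
      filter_upwards [(test_memLp φ).coeFn_toLp] with x hx
      change ψ x * ((test_memLp φ).toLp φ) x = _
      rw [hx]
    rw [h1]
    refine setIntegral_eq_integral_of_forall_compl_eq_zero fun x hx ↦ ?_
    rw [image_eq_zero_of_notMem_tsupport fun h ↦ hx (ψ.tsupport_subset h), zero_mul]
  have hi (φ ψ : 𝓓(Ω, ℝ)) : Integrable (fun x ↦ ψ x * φ x) :=
    (ψ.continuous.mul φ.continuous).integrable_of_hasCompactSupport
      ψ.hasCompactSupport.mul_right
  have hd (φ : 𝓓(Ω, ℝ)) (j : Fin d) (x : Rn d) :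
      (∂_{e j} φ) x = fderiv ℝ φ x (e j) := by
    rw [TestFunction.lineDerivOp_eq_lineDerivCLM ℝ, TestFunction.lineDerivCLM_eq_fderivCLM,
      TestFunction.fderivCLM_apply_of_le _ (by simp)]
  intro j
  ext ψ
  rw [Distribution.lineDerivOp_apply_apply, map_neg]
  change - toDist (testL2 Ω φ) (∂_{e j} ψ) = toDist (testL2 Ω (∂_{e j} φ)) ψ
  rw [key, key]
  simp_rw [hd]
  rw [integral_mul_fderiv_eq_neg_fderiv_mul_of_integrable]
  · simpa only [hd] using hi φ (∂_{e j} ψ)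
  · simpa only [hd] using hi (∂_{e j} φ) ψ
  · exact hi φ ψ
  · exact fun x _ ↦ (ψ.contDiff.differentiable (by simp)) x
  · exact fun x _ ↦ (φ.contDiff.differentiable (by simp)) x

/-- The inclusion of the test functions into `H¹(Ω)`. -/
def testH1 {d : ℕ} (Ω : Opens (Rn d)) : 𝓓(Ω, ℝ) →ₗ[ℝ] H1 Ω :=
  LinearMap.codRestrict (H1 Ω)
    ((testL2 Ω).prod (LinearMap.pi fun j ↦
      testL2 Ω ∘ₗ (TestFunction.lineDerivCLM ℝ (e j) : 𝓓(Ω, ℝ) →L[ℝ] 𝓓(Ω, ℝ)).toLinearMap))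
    testL2_mem_H1

/-- `H¹₀(Ω)`: the closure of the test functions in `H¹(Ω)`. -/
def H10 {d : ℕ} (Ω : Opens (Rn d)) : Submodule ℝ (H1 Ω) :=
  (LinearMap.range (testH1 Ω)).topologicalClosure

/-- The inclusion of the test functions into `H¹₀(Ω)`. -/
def testH10 {d : ℕ} (Ω : Opens (Rn d)) : 𝓓(Ω, ℝ) →ₗ[ℝ] H10 Ω :=
  LinearMap.codRestrict (H10 Ω) (testH1 Ω)
    fun φ ↦ Submodule.le_topologicalClosure _ (LinearMap.mem_range_self _ φ)

/-- The underlying `L²` function of an element of `H¹₀(Ω)`. -/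
def fn {d : ℕ} (Ω : Opens (Rn d)) : H10 Ω →ₗ[ℝ] L2 Ω :=
  LinearMap.fst ℝ _ _ ∘ₗ (H1 Ω).subtype ∘ₗ (H10 Ω).subtype

/-- The weak partial derivative `∂_j` on `H¹₀(Ω)`. -/
def pd {d : ℕ} (Ω : Opens (Rn d)) (j : Fin d) : H10 Ω →ₗ[ℝ] L2 Ω :=
  LinearMap.proj j ∘ₗ LinearMap.snd ℝ _ _ ∘ₗ (H1 Ω).subtype ∘ₗ (H10 Ω).subtype

/-- The space of vector fields `𝐇¹₀(Ω) = H¹₀(Ω)^d`. -/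
abbrev H10v {d : ℕ} (Ω : Opens (Rn d)) := Fin d → H10 Ω

/-- `𝐇⁻¹(Ω)`: the space of continuous linear forms on `𝐇¹₀(Ω)`. Continuity is with respect to the
`H¹` topology, which on a bounded `Ω` is also that of the norm `‖∇v‖` by Poincaré's inequality. -/
abbrev Hm1 {d : ℕ} (Ω : Opens (Rn d)) := H10v Ω →L[ℝ] ℝ

/-- The divergence `div : 𝐇¹₀(Ω) → L²(Ω)`. -/
def divergence {d : ℕ} (Ω : Opens (Rn d)) : H10v Ω →ₗ[ℝ] L2 Ω :=
  ∑ i, pd Ω i ∘ₗ LinearMap.proj i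

/-- The inner product `(v, w) = ∑_{i,j} (∂_j v_i, ∂_j w_i)_{L²}` of `𝐇¹₀(Ω)`. -/
def gradInner {d : ℕ} {Ω : Opens (Rn d)} (v w : H10v Ω) : ℝ :=
  ∑ i, ∑ j, inner ℝ (pd Ω j (v i)) (pd Ω j (w i))

/-- `V`: the divergence-free fields of `𝐇¹₀(Ω)`. -/
def V {d : ℕ} (Ω : Opens (Rn d)) : Submodule ℝ (H10v Ω) := LinearMap.ker (divergence Ω)

/-- The orthogonal complement of `V` in `𝐇¹₀(Ω)` for the inner product `gradInner`. -/
def Vperp {d : ℕ} (Ω : Opens (Rn d)) : Set (H10v Ω) := {v | ∀ w ∈ V Ω, gradInner v w = 0}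

/-! ### Gradient and curl in the sense of distributions -/

/-- The gradient of a distribution. -/
def grad {d : ℕ} {Ω : Opens (Rn d)} (s : 𝓓'(Ω, ℝ)) : Fin d → 𝓓'(Ω, ℝ) := fun i ↦ ∂_{e i} s

/-- The scalar curl of a planar vector field. -/
def curl2 {Ω : Opens (Rn 2)} (w : Fin 2 → 𝓓'(Ω, ℝ)) : 𝓓'(Ω, ℝ) :=
  ∂_{(e 0 : Rn 2)} (w 1) - ∂_{(e 1 : Rn 2)} (w 0)

/-- The vector curl of a scalar in the plane. -/
def vcurl2 {Ω : Opens (Rn 2)} (s : 𝓓'(Ω, ℝ)) : Fin 2 → 𝓓'(Ω, ℝ) :=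
  ![∂_{(e 1 : Rn 2)} s, - ∂_{(e 0 : Rn 2)} s]

/-- The curl of a vector field in three dimensions. -/
def curl3 {Ω : Opens (Rn 3)} (w : Fin 3 → 𝓓'(Ω, ℝ)) : Fin 3 → 𝓓'(Ω, ℝ) :=
  ![∂_{(e 1 : Rn 3)} (w 2) - ∂_{(e 2 : Rn 3)} (w 1),
    ∂_{(e 2 : Rn 3)} (w 0) - ∂_{(e 0 : Rn 3)} (w 2),
    ∂_{(e 0 : Rn 3)} (w 1) - ∂_{(e 1 : Rn 3)} (w 0)]

/-- The operator `curl curl` in dimensions two and three (only these dimensions are used). -/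
def curlCurl : {d : ℕ} → {Ω : Opens (Rn d)} → (Fin d → 𝓓'(Ω, ℝ)) → (Fin d → 𝓓'(Ω, ℝ))
  | 2, _, w => vcurl2 (curl2 w)
  | 3, _, w => curl3 (curl3 w)
  | _, _, _ => 0

/-- `f = grad z + curl curl w` in the sense of distributions on `Ω`: both sides agree on every
vector field `φ eᵢ` with `φ` a test function, hence on all test vector fields. -/
def IsDecomposition {d : ℕ} {Ω : Opens (Rn d)} (f : Hm1 Ω) (z : L2 Ω) (w : H10v Ω) : Prop :=
  ∀ (i : Fin d) (φ : 𝓓(Ω, ℝ)),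
    f (Pi.single i (testH10 Ω φ)) =
      (grad (toDist z) i + curlCurl (fun k ↦ toDist (fn Ω (w k))) i) φ

/-! ### The variational right-hand side and the transformed test functions -/

/-- The right-hand side `ℓ(v, q) = ⟨f, v⟩ - (g, q)` of the Stokes problem with data `(f, g)`, on
`𝐇¹₀(Ω) × L²_zmv(Ω)`. -/
def rhs {d : ℕ} {Ω : Opens (Rn d)} (f : Hm1 Ω) (g : L2zmv Ω) (p : H10v Ω × L2zmv Ω) : ℝ :=
  f p.1 - inner ℝ (g : L2 Ω) (p.2 : L2 Ω)

/-- The image `T_λ(v, q) = (λ v - ν⁻¹ ṽ_q, -λ q)`, where `vq` stands for `ṽ_q`. -/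
def transform {d : ℕ} {Ω : Opens (Rn d)} (ν lam : ℝ) (vq v : H10v Ω) (q : L2zmv Ω) :
    H10v Ω × L2zmv Ω :=
  (lam • v - ν⁻¹ • vq, -(lam • q))

end

end Stokes

namespace Stokes

/-! ### Calculus of distributional derivatives -/

/-! The core is a formula valid for every field `v` of `𝐇¹₀(Ω)`: `⟨f, v⟩ = -(z, div v) + (w, v)`,
proved in `IsDecomposition.apply_eq`. Since `div w = 0`, the identity `curl curl = grad div - Δ`
reduces `curl curl w` to `-Δw`. Tested against `φ eᵢ`, one integration by parts in each of `grad z`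
and `-Δw` gives the formula. Both sides are continuous in the `H¹` topology and test functions are
dense in `H¹₀(Ω)`, so it extends to all `v`. For `v = ṽ_q` the term `(w, v)` vanishes by
orthogonality to `V`, and `div v = q` leaves `-(z, q)`. The expression of `ℓ ∘ T_λ` then follows by
linearity, the factor `-ν⁻¹` reversing the sign. -/

lemma test_lineDeriv_apply {d : ℕ} {Ω : Opens (Rn d)} (φ : 𝓓(Ω, ℝ)) (a x : Rn d) :
    (∂_{a} φ) x = fderiv ℝ φ x a := by
  rw [TestFunction.lineDerivOp_eq_lineDerivCLM ℝ, TestFunction.lineDerivCLM_eq_fderivCLM,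
    TestFunction.fderivCLM_apply_of_le _ (by simp)]

lemma test_lineDeriv_comm {d : ℕ} {Ω : Opens (Rn d)} (φ : 𝓓(Ω, ℝ)) (a b : Rn d) :
    ∂_{a} (∂_{b} φ) = ∂_{b} (∂_{a} φ) := by
  ext x
  have hfun (c : Rn d) : ((∂_{c} φ : 𝓓(Ω, ℝ)) : Rn d → ℝ) = fun y ↦ fderiv ℝ φ y c :=
    funext (test_lineDeriv_apply φ c)
  have hφ : ContDiff ℝ 2 φ := φ.contDiff.of_le (by norm_cast)
  have hd : DifferentiableAt ℝ (fderiv ℝ φ) x :=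
    (hφ.fderiv_right (m := 1) (by norm_num)).differentiable (by norm_num) x
  have hsymm : IsSymmSndFDerivAt ℝ φ x := hφ.contDiffAt.isSymmSndFDerivAt (by simp)
  rw [test_lineDeriv_apply, test_lineDeriv_apply, hfun, hfun,
    fderiv_clm_apply hd (differentiableAt_const _), fderiv_clm_apply hd (differentiableAt_const _)]
  simpa using hsymm a b

lemma dist_lineDeriv_comm {d : ℕ} {Ω : Opens (Rn d)} (T : 𝓓'(Ω, ℝ)) (a b : Rn d) :
    ∂_{a} (∂_{b} T) = ∂_{b} (∂_{a} T) := by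
  ext φ
  -- By duality both derivatives fall on the test function; the two signs cancel, leaving the
  -- symmetry of second derivatives of `φ`.
  simp only [Distribution.lineDerivOp_apply_apply, LineDeriv.lineDerivOp_neg, neg_neg]
  rw [test_lineDeriv_comm]

/-- `curl curl = grad div - Δ` in dimensions two and three. -/
lemma curlCurl_eq {d : ℕ} (hd : d = 2 ∨ d = 3) {Ω : Opens (Rn d)} (W : Fin d → 𝓓'(Ω, ℝ))
    (i : Fin d) :
    curlCurl W i = ∂_{(e i : Rn d)} (∑ j, ∂_{(e j : Rn d)} (W j)) -
      ∑ j, ∂_{(e j : Rn d)} (∂_{(e j : Rn d)} (W i)) := by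
  have sub (a : Rn d) (S T : 𝓓'(Ω, ℝ)) : ∂_{a} (S - T) = ∂_{a} S - ∂_{a} T := by
    rw [sub_eq_add_neg, LineDeriv.lineDerivOp_add, LineDeriv.lineDerivOp_neg, ← sub_eq_add_neg]
  have c := dist_lineDeriv_comm (Ω := Ω)
  rcases hd with rfl | rfl
  · fin_cases i
    · simp only [curlCurl, vcurl2, curl2, Fin.sum_univ_two, LineDeriv.lineDerivOp_add, sub,
        Fin.zero_eta, Matrix.cons_val_zero]
      -- The pure derivatives `∂ᵢ∂ᵢ Wᵢ` cancel between `grad div` and `Δ`; only the order of the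
      -- mixed derivatives has to be matched. The other components, in both dimensions, follow the
      -- same pattern.
      rw [c (W 1) (e 1) (e 0)]
      abel
    · simp only [curlCurl, vcurl2, curl2, Fin.sum_univ_two, LineDeriv.lineDerivOp_add, sub,
        Fin.mk_one, Matrix.cons_val_one, Matrix.cons_val_fin_one]
      rw [c (W 0) (e 1) (e 0)]
      abel
  · fin_cases i
    · simp [curlCurl, curl3, Fin.sum_univ_three, LineDeriv.lineDerivOp_add, sub]
      rw [c (W 1) (e 1) (e 0), c (W 2) (e 2) (e 0)]
      abel
    · simp [curlCurl, curl3, Fin.sum_univ_three, LineDeriv.lineDerivOp_add, sub]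
      rw [c (W 2) (e 2) (e 1), c (W 0) (e 0) (e 1)]
      abel
    · simp [curlCurl, curl3, Fin.sum_univ_three, LineDeriv.lineDerivOp_add, sub]
      rw [c (W 0) (e 0) (e 2), c (W 1) (e 1) (e 2)]
      abel

lemma curlCurl_eq_neg_of_div_eq_zero {d : ℕ} (hd : d = 2 ∨ d = 3) {Ω : Opens (Rn d)}
    {W : Fin d → 𝓓'(Ω, ℝ)} (hW : ∑ j, ∂_{(e j : Rn d)} (W j) = 0) (i : Fin d) :
    curlCurl W i = - ∑ j, ∂_{(e j : Rn d)} (∂_{(e j : Rn d)} (W i)) := by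
  rw [curlCurl_eq hd, hW, LineDeriv.lineDerivOp_zero, zero_sub]

/-! ### Weak derivatives and test functions -/

lemma divergence_apply {d : ℕ} {Ω : Opens (Rn d)} (v : H10v Ω) :
    divergence Ω v = ∑ i, pd Ω i (v i) :=
  LinearMap.sum_apply _ _ _

lemma gradInner_comm {d : ℕ} {Ω : Opens (Rn d)} (v w : H10v Ω) :
    gradInner v w = gradInner w v :=
  Finset.sum_congr rfl fun i _ ↦ Finset.sum_congr rfl fun j _ ↦
    real_inner_comm (pd Ω j (w i)) (pd Ω j (v i))

lemma lineDeriv_toDist_fn {d : ℕ} {Ω : Opens (Rn d)} (u : H10 Ω) (j : Fin d) :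
    ∂_{e j} (toDist (fn Ω u)) = toDist (pd Ω j u) :=
  (u : H1 Ω).2 j

lemma pd_testH10 {d : ℕ} {Ω : Opens (Rn d)} (φ : 𝓓(Ω, ℝ)) (j : Fin d) :
    pd Ω j (testH10 Ω φ) = testL2 Ω (∂_{e j} φ) := rfl

lemma toDist_eq_inner {d : ℕ} {Ω : Opens (Rn d)} (u : L2 Ω) (φ : 𝓓(Ω, ℝ)) :
    toDist u φ = inner ℝ u (testL2 Ω φ) := by
  rw [toDist_apply, MeasureTheory.L2.inner_def]
  refine integral_congr_ae ?_
  filter_upwards [(test_memLp φ).coeFn_toLp] with x hx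
  change φ x * u x = inner ℝ (u x) (((test_memLp φ).toLp φ) x)
  rw [hx]
  simp

/-- The right-hand side goes through `pd` of `testH10 Ω φ` rather than the derivative of `φ`, so
that it makes sense for any element of `H¹₀(Ω)` and can be extended by density. -/
lemma lineDeriv_toDist_apply {d : ℕ} {Ω : Opens (Rn d)} (u : L2 Ω) (j : Fin d) (φ : 𝓓(Ω, ℝ)) :
    (∂_{e j} (toDist u)) φ = - inner ℝ u (pd Ω j (testH10 Ω φ)) := by
  rw [pd_testH10, Distribution.lineDerivOp_apply_apply, map_neg, toDist_eq_inner]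

/-- Only the outer derivative is moved to the test function; the inner one is already an `L²`
function. -/
lemma lineDeriv_lineDeriv_toDist_fn_apply {d : ℕ} {Ω : Opens (Rn d)} (u : H10 Ω) (j : Fin d)
    (φ : 𝓓(Ω, ℝ)) :
    (∂_{e j} (∂_{e j} (toDist (fn Ω u)))) φ =
      - inner ℝ (pd Ω j u) (pd Ω j (testH10 Ω φ)) :=
  (congrArg (fun T : 𝓓'(Ω, ℝ) ↦ (∂_{e j} T) φ) (lineDeriv_toDist_fn u j)).trans
    (lineDeriv_toDist_apply _ j φ)

lemma sum_lineDeriv_toDist_fn_eq_zero {d : ℕ} {Ω : Opens (Rn d)} {w : H10v Ω} (hw : w ∈ V Ω) :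
    ∑ j, ∂_{e j} (toDist (fn Ω (w j))) = 0 := by
  have hsum : ∑ j, pd Ω j (w j) = 0 := (divergence_apply w).symm.trans hw
  let D : L2 Ω →ₗ[ℝ] 𝓓'(Ω, ℝ) :=
    { toFun := toDist, map_add' := toDist_add, map_smul' := toDist_smul }
  calc ∑ j, ∂_{e j} (toDist (fn Ω (w j))) = ∑ j, D (pd Ω j (w j)) :=
        Finset.sum_congr rfl fun j _ ↦ lineDeriv_toDist_fn _ j
    _ = 0 := by rw [← map_sum, hsum, map_zero]

lemma curlCurl_toDist_fn {d : ℕ} (hd : d = 2 ∨ d = 3) {Ω : Opens (Rn d)} {w : H10v Ω}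
    (hw : w ∈ V Ω) (i : Fin d) :
    curlCurl (fun k ↦ toDist (fn Ω (w k))) i =
      - ∑ j, ∂_{(e j : Rn d)} (∂_{(e j : Rn d)} (toDist (fn Ω (w i)))) :=
  curlCurl_eq_neg_of_div_eq_zero hd (sum_lineDeriv_toDist_fn_eq_zero hw) i

lemma denseRange_testH10 {d : ℕ} (Ω : Opens (Rn d)) : DenseRange (testH10 Ω) := by
  intro u
  -- Closure in the subspace `H10 Ω` is tested in `H1 Ω`, where `H10 Ω` is by definition the closure
  -- of the test functions.
  rw [closure_subtype, ← Set.range_comp]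
  exact u.2

lemma continuous_pd {d : ℕ} (Ω : Opens (Rn d)) (j : Fin d) : Continuous (pd Ω j) :=
  (continuous_apply j).comp
    (continuous_snd.comp (continuous_subtype_val.comp continuous_subtype_val))

/-! ### The action of a decomposed functional -/

lemma IsDecomposition.apply_test {d : ℕ} (hd : d = 2 ∨ d = 3) {Ω : Opens (Rn d)} {f : Hm1 Ω}
    {z : L2 Ω} {w : H10v Ω} (hw : w ∈ V Ω) (hf : IsDecomposition f z w) (i : Fin d)
    (φ : 𝓓(Ω, ℝ)) :
    f (Pi.single i (testH10 Ω φ)) = - inner ℝ z (pd Ω i (testH10 Ω φ)) +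
      ∑ j, inner ℝ (pd Ω j (w i)) (pd Ω j (testH10 Ω φ)) := by
  let ev : 𝓓'(Ω, ℝ) →+ ℝ := ⟨⟨fun S ↦ S φ, rfl⟩, fun _ _ ↦ rfl⟩
  have hlap : ev (∑ j, ∂_{e j} (∂_{e j} (toDist (fn Ω (w i))))) =
      - ∑ j, inner ℝ (pd Ω j (w i)) (pd Ω j (testH10 Ω φ)) :=
    (map_sum ev _ _).trans ((Finset.sum_congr rfl fun j _ ↦
      lineDeriv_lineDeriv_toDist_fn_apply (w i) j φ).trans (Finset.sum_neg_distrib _))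
  calc f (Pi.single i (testH10 Ω φ))
      = ev (∂_{e i} (toDist z)) + ev (curlCurl (fun k ↦ toDist (fn Ω (w k))) i) := hf i φ
    -- The minus sign in `curl curl w = -Δw` cancels the one from integrating by parts.
    _ = _ := congrArg₂ (· + ·) (lineDeriv_toDist_apply z i φ)
        ((congrArg ev (curlCurl_toDist_fn hd hw i)).trans ((ev.map_neg _).trans
          (neg_eq_iff_eq_neg.2 hlap)))

/-- Both sides are continuous in `u` and agree on the dense range of `testH10 Ω`. -/
lemma IsDecomposition.apply_single {d : ℕ} (hd : d = 2 ∨ d = 3) {Ω : Opens (Rn d)} {f : Hm1 Ω}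
    {z : L2 Ω} {w : H10v Ω} (hw : w ∈ V Ω) (hf : IsDecomposition f z w) (i : Fin d)
    (u : H10 Ω) :
    f (Pi.single i u) = - inner ℝ z (pd Ω i u) + ∑ j, inner ℝ (pd Ω j (w i)) (pd Ω j u) := by
  have hl : Continuous fun u : H10 Ω ↦ f (Pi.single i u) :=
    f.continuous.comp (continuous_single (A := fun _ ↦ H10 Ω) i)
  have hr : Continuous fun u : H10 Ω ↦
      - inner ℝ z (pd Ω i u) + ∑ j, inner ℝ (pd Ω j (w i)) (pd Ω j u) :=
    (continuous_const.inner (continuous_pd Ω i)).neg.add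
      (continuous_finsetSum _ fun j _ ↦ continuous_const.inner (continuous_pd Ω j))
  exact congrFun ((denseRange_testH10 Ω).equalizer hl hr
    (funext fun φ ↦ hf.apply_test hd hw i φ)) u

/-- If `f = grad z + curl curl w` with `w` divergence-free, then
`⟨f, v⟩ = -(z, div v) + (w, v)` on the whole of `𝐇¹₀(Ω)`. -/
theorem IsDecomposition.apply_eq {d : ℕ} (hd : d = 2 ∨ d = 3) {Ω : Opens (Rn d)} {f : Hm1 Ω}
    {z : L2 Ω} {w : H10v Ω} (hw : w ∈ V Ω) (hf : IsDecomposition f z w) (v : H10v Ω) :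
    f v = - inner ℝ z (divergence Ω v) + gradInner w v := by
  have hinner : inner ℝ z (divergence Ω v) = ∑ i, inner ℝ z (pd Ω i (v i)) :=
    (congrArg (inner ℝ z) (divergence_apply v)).trans (inner_sum _ _ _)
  calc f v = ∑ i, f (Pi.single i (v i)) :=
        (congrArg f (Finset.univ_sum_single v).symm).trans (map_sum f _ _)
    _ = ∑ i, (- inner ℝ z (pd Ω i (v i)) + ∑ j, inner ℝ (pd Ω j (w i)) (pd Ω j (v i))) :=
        Finset.sum_congr rfl fun i _ ↦ hf.apply_single hd hw i (v i)
    _ = - ∑ i, inner ℝ z (pd Ω i (v i)) + gradInner w v :=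
        Finset.sum_add_distrib.trans (congrArg (· + gradInner w v) (Finset.sum_neg_distrib _))
    _ = - inner ℝ z (divergence Ω v) + gradInner w v :=
        congrArg (fun r ↦ - r + gradInner w v) hinner.symm

lemma IsDecomposition.apply_eq_of_mem_Vperp {d : ℕ} (hd : d = 2 ∨ d = 3) {Ω : Opens (Rn d)}
    {f : Hm1 Ω} {z : L2 Ω} {w : H10v Ω} (hw : w ∈ V Ω) (hf : IsDecomposition f z w)
    {v : H10v Ω} (hv : v ∈ Vperp Ω) {q : L2 Ω} (hdiv : divergence Ω v = q) :
    f v = - inner ℝ z q := by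
  have h := hf.apply_eq hd hw v
  -- Orthogonality of `v` to `w ∈ V` removes the contribution of `curl curl w`.
  rw [(gradInner_comm w v).trans (hv w hw), add_zero] at h
  exact h.trans (congrArg (fun p ↦ - inner ℝ z p) hdiv)

lemma rhs_zero_transform {d : ℕ} {Ω : Opens (Rn d)} (f : Hm1 Ω) (ν lam : ℝ) (vq v : H10v Ω)
    (q : L2zmv Ω) :
    rhs f 0 (transform ν lam vq v q) = lam * f v - ν⁻¹ * f vq := by
  have hf : f (lam • v - ν⁻¹ • vq) = lam * f v - ν⁻¹ * f vq :=
    (map_sub f (lam • v) (ν⁻¹ • vq)).trans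
      (congrArg₂ (· - ·) (map_smul f lam v) (map_smul f ν⁻¹ vq))
  exact (congrArg₂ (· - ·) hf (inner_zero_left _)).trans (sub_zero _)

end Stokes

theorem mainTheorem8 {d : ℕ} (hd : d = 2 ∨ d = 3) (Ω : Opens (Stokes.Rn d))
    (hΩ : IsConnected (Ω : Set (Stokes.Rn d)))
    (hΩb : Bornology.IsBounded (Ω : Set (Stokes.Rn d)))
    (f : Stokes.Hm1 Ω) (z : Stokes.L2zmv Ω) (w : Stokes.H10v Ω) (hw : w ∈ Stokes.V Ω)
    (hf : Stokes.IsDecomposition f (z : Stokes.L2 Ω) w)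
    (q : Stokes.L2zmv Ω) (vq : Stokes.H10v Ω) (hvq : vq ∈ Stokes.Vperp Ω)
    (hdiv : Stokes.divergence Ω vq = (q : Stokes.L2 Ω)) :
    f vq = - inner ℝ (z : Stokes.L2 Ω) (q : Stokes.L2 Ω) ∧
      ∀ (ν lam : ℝ) (_ : 0 < ν) (v : Stokes.H10v Ω),
        Stokes.rhs f 0 (Stokes.transform ν lam vq v q) =
          lam * f v + ν⁻¹ * inner ℝ (z : Stokes.L2 Ω) (q : Stokes.L2 Ω) := by
  have key : f vq = - inner ℝ (z : Stokes.L2 Ω) (q : Stokes.L2 Ω) :=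
    hf.apply_eq_of_mem_Vperp hd hw hvq hdiv
  refine ⟨key, fun ν lam _ v ↦ ?_⟩
  rw [Stokes.rhs_zero_transform, key]
  ring
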